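/- Let $n\ge 0$ be an integer, let $A\in\mathbb{C}^{n\times n}$, and let $G,H\in\mathbb{C}^{n\times n}$ be (Hermitian) positive semidefinite. Write $X\succeq Y$ if $X-Y$ is positive semidefinite. For positive semidefinite $X$ (for which $I+GX$ is invertible) put $$R_d(X)=H+A^*X(I+GX)^{-1}A,\qquad T_X=(I+GX)^{-1}A ,$$ and consider the discrete-time algebraic Riccati equation (DARE) $X=R_d(X)$. Assume that the set $\mathbb{R}_{\ge}=\{X\succeq 0: X\succeq R_d(X)\}$ is nonempty, and let $(X_k)_{k\ge1}$ be defined by $X_1=H$ and $X_{k+1}=R_d(X_k)$. Then the DARE has a minimal positive semidefinite solution $X_\star$, that is, a positive semidefinite solution with $X_\star\preceq Y$ for every positive semidefinite solution $Y$, and the following holds. 1. If $H\neq0$, then $X_k\to X_\star$, the spectrum $\sigma(T_{X_\star})$ meets the open unit disk $\mathbb{D}$, and for every norm $\|\cdot\|$ on $\mathbb{C}^{n\times n}$ (in particular for every induced matrix norm) the convergence is R-linear, i.e. $\limsup_{k\to\infty}\|X_k-X_\star\|^{1/k}\le\sigma$ for some $\sigma\in(0,1)$; moreover $$\limsup_{k\to\infty}\|X_k-X_\star\|^{1/k}\le\max\{|\lambda|^2:\lambda\in\sigma(T_{X_\star})\cap\mathbb{D}\}<1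 .$$ No condition is imposed on the spectral radius $\rho(T_{X_\star})$; in particular $\rho(T_{X_\star})\ge1$ is allowed. 2. If $H=0$, then $X_\star=X_k=0$ for all $k\ge1$, and $\rho(T_{X_\star})=\rho(A)$. -/

import Mathlib

open scoped ComplexOrder

noncomputable section

namespace DARE

/-- The Riccati operator `R_d(X) = H + A^* X (I + G X)^{-1} A`. For positive semidefinite
`G` and `X`, the only case in which it is used, `I + G X` is invertible. -/
def riccati {n : ℕ} (A G H X : Matrix (Fin n) (Fin n) ℂ) : Matrix (Fin n) (Fin n) ℂ :=
  H + A.conjTranspose * X * (1 + G * X)⁻¹ * A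

/-- The closed-loop matrix `T_X = (I + G X)^{-1} A`. -/
def closedLoop {n : ℕ} (A G X : Matrix (Fin n) (Fin n) ℂ) : Matrix (Fin n) (Fin n) ℂ :=
  (1 + G * X)⁻¹ * A

/-- The set `R_≥` of the positive semidefinite `X` with `X ≥ R_d(X)` in the Loewner order. -/
def superSolutions {n : ℕ} (A G H : Matrix (Fin n) (Fin n) ℂ) :
    Set (Matrix (Fin n) (Fin n) ℂ) :=
  {X | X.PosSemidef ∧ (X - riccati A G H X).PosSemidef}

/-- `X` is a positive semidefinite solution of the equation `X = R_d(X)`. -/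
def IsPSDSolution {n : ℕ} (A G H X : Matrix (Fin n) (Fin n) ℂ) : Prop :=
  X.PosSemidef ∧ X = riccati A G H X

/-- `X` is the minimal positive semidefinite solution: it is a positive semidefinite solution
and lies below every other one in the Loewner order. -/
def IsMinimalPSDSolution {n : ℕ} (A G H X : Matrix (Fin n) (Fin n) ℂ) : Prop :=
  IsPSDSolution A G H X ∧ ∀ Y, IsPSDSolution A G H Y → (Y - X).PosSemidef

/-- `limsup_{k → ∞} ν(X_k - L)^{1/k}`, as an extended real number, so that no boundedness
is presupposed. -/
def rootRate {n : ℕ} (ν : Seminorm ℂ (Matrix (Fin n) (Fin n) ℂ))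
    (X : ℕ → Matrix (Fin n) (Fin n) ℂ) (L : Matrix (Fin n) (Fin n) ℂ) : EReal :=
  Filter.limsup (fun k : ℕ => ((ν (X k - L) ^ (1 / (k : ℝ)) : ℝ) : EReal)) Filter.atTop

/-- R-linear convergence of `X_k` to `L` with respect to `ν`. -/
def RLinearlyConverges {n : ℕ} (ν : Seminorm ℂ (Matrix (Fin n) (Fin n) ℂ))
    (X : ℕ → Matrix (Fin n) (Fin n) ℂ) (L : Matrix (Fin n) (Fin n) ℂ) : Prop :=
  ∃ σ : ℝ, 0 < σ ∧ σ < 1 ∧ rootRate ν X L ≤ (σ : EReal)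

/-- The numbers `|z|²` for the eigenvalues `z` of `T` in the open unit disk. -/
def stableSqModuli {n : ℕ} (T : Matrix (Fin n) (Fin n) ℂ) : Set ℝ :=
  {s | ∃ z ∈ spectrum ℂ T, ‖z‖ < 1 ∧ s = ‖z‖ ^ 2}

end DARE

end

/-!
The iteration started at `0` has `X₁ = H` as its first step. With `T = T_Y`, the whole argument
rests on one identity (`riccati_sub_riccati`), valid for positive semidefinite `X` and `Y`:
`R_d(Y) - R_d(X) = T* (E + E (I + G X)⁻¹ G E) T`, where `E = Y - X`.

It shows that `R_d` is monotone, so the iterates increase and stay below every supersolution;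
they therefore converge (`exists_tendsto_of_monotone`), and the same identity identifies the limit
`L` as a solution, which is minimal (`exists_minimal_tendsto`).

For the rate, take `Y = L` and let `E_k` be the error of the `k`-th iterate. Dropping the
quadratic term gives `E_m ≥ T^{m*} L T^m`, hence `L T^m → 0`, with no assumption on the spectral
radius of `T`. As `T* L T ≤ L`, the subspace `ker L` is `T`-invariant, and every eigenvalue of the
map that `T` induces modulo `ker L` lies in the open unit disk and is an eigenvalue of `T`. If
`H ≠ 0`, then `L ≠ 0` and the quotient is nontrivial, so such eigenvalues exist
(`exists_isGreatest_stableSqModuli`).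

The unstable part of `T` does not affect the errors, because `0 ≤ E_k ≤ L` makes them vanish on
`ker L`: with a projection `P` along `ker L` one has `E_k = P* E_k P`. Since `E_k → 0`, the
quadratic term is eventually at most a small multiple of `E_k`, so that
`E_{k+1} ≤ (1 + δ) (P T)* E_k (P T)`. Gelfand's formula for `P T`, whose nonzero eigenvalues are
those of the quotient map, then yields the rate (`exists_norm_sub_iterate_le`).
-/

namespace DARE

section

open Matrix Filter Topology
open scoped MatrixOrder Matrix.Norms.L2Operator

variable {n : ℕ} {A G H X Y : Matrix (Fin n) (Fin n) ℂ}

/-! ### The difference of two values of the Riccati operator -/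

theorem isUnit_one_add_mul (hG : G.PosSemidef) (hX : X.PosSemidef) : IsUnit (1 + G * X) := by
  rw [← Matrix.mulVec_injective_iff_isUnit]
  refine (injective_iff_map_eq_zero (Matrix.mulVecLin (1 + G * X))).2 fun v hv => ?_
  simp only [mulVecLin_apply, add_mulVec, one_mulVec, ← mulVec_mulVec] at hv
  have hv' : v = -(G *ᵥ (X *ᵥ v)) := eq_neg_of_add_eq_zero_left hv
  have h1 : star v ⬝ᵥ (X *ᵥ v) = -(star (X *ᵥ v) ⬝ᵥ (G *ᵥ (X *ᵥ v))) := by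
    have h3 : star v ⬝ᵥ (X *ᵥ v) = star (X *ᵥ v) ⬝ᵥ v := by
      rw [star_mulVec, hX.1.eq, ← dotProduct_mulVec]
    rw [h3]
    nth_rewrite 2 [hv']
    rw [dotProduct_neg]
  have h2 : star v ⬝ᵥ (X *ᵥ v) = 0 :=
    le_antisymm (h1 ▸ neg_nonpos.2 (hG.dotProduct_mulVec_nonneg _)) (hX.dotProduct_mulVec_nonneg v)
  have h3 : X *ᵥ v = 0 := (hX.dotProduct_mulVec_zero_iff v).1 h2
  rw [hv', h3, mulVec_zero, neg_zero]

theorem inv_mul_self (hG : G.PosSemidef) (hX : X.PosSemidef) : (1 + G * X)⁻¹ * (1 + G * X) = 1 :=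
  Matrix.nonsing_inv_mul _ ((Matrix.isUnit_iff_isUnit_det _).1 (isUnit_one_add_mul hG hX))

theorem mul_inv_self (hG : G.PosSemidef) (hX : X.PosSemidef) : (1 + G * X) * (1 + G * X)⁻¹ = 1 :=
  Matrix.mul_nonsing_inv _ ((Matrix.isUnit_iff_isUnit_det _).1 (isUnit_one_add_mul hG hX))

theorem conjTranspose_inv_mul_self (hG : G.PosSemidef) (hX : X.PosSemidef) :
    ((1 + G * X)⁻¹)ᴴ * (1 + X * G) = 1 := by
  simpa [hG.1.eq, hX.1.eq] using congrArg conjTranspose (mul_inv_self hG hX)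

theorem conjTranspose_mul_inv_self (hG : G.PosSemidef) (hX : X.PosSemidef) :
    (1 + X * G) * ((1 + G * X)⁻¹)ᴴ = 1 := by
  simpa [hG.1.eq, hX.1.eq] using congrArg conjTranspose (inv_mul_self hG hX)

/-- The matrix `(I + G X)⁻¹ G`, the weight of the quadratic term in the difference of two
values of the Riccati operator. -/
noncomputable def gain (G X : Matrix (Fin n) (Fin n) ℂ) : Matrix (Fin n) (Fin n) ℂ :=
  (1 + G * X)⁻¹ * G

theorem gain_nonneg (hG : G.PosSemidef) (hX : X.PosSemidef) : 0 ≤ gain G X := by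
  set N := (1 + G * X)⁻¹ with hN
  have h : gain G X = N * (G + G * X * G) * Nᴴ := by
    calc gain G X = N * G * ((1 + X * G) * Nᴴ) := by
          rw [conjTranspose_mul_inv_self hG hX, mul_one, gain]
      _ = N * (G + G * X * G) * Nᴴ := by noncomm_ring
  rw [h]
  have h2 : (G * X * G).PosSemidef := by
    simpa [hG.1.eq] using hX.conjTranspose_mul_mul_same G
  exact ((hG.add h2).mul_mul_conjTranspose_same N).nonneg

/-- The difference `R_d(Y) - R_d(X)` as a congruence by the closed-loop matrix of `Y` alone. -/
theorem riccati_sub_riccati (A H : Matrix (Fin n) (Fin n) ℂ)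
    (hG : G.PosSemidef) (hX : X.PosSemidef) (hY : Y.PosSemidef) :
    riccati A G H Y - riccati A G H X =
      (closedLoop A G Y)ᴴ * ((Y - X) + (Y - X) * gain G X * (Y - X)) * closedLoop A G Y := by
  set N := (1 + G * X)⁻¹ with hN
  set M := (1 + G * Y)⁻¹ with hM
  have hN1 : N * (1 + G * X) = 1 := inv_mul_self hG hX
  have hN2 : (1 + G * X) * N = 1 := mul_inv_self hG hX
  have hM2 : (1 + G * Y) * M = 1 := mul_inv_self hG hY
  have hM3 : Mᴴ * (1 + Y * G) = 1 := conjTranspose_inv_mul_self hG hY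
  have h1 : (Y - X) + (Y - X) * (N * G) * (Y - X) = (Y - X) * N * (1 + G * Y) := by
    calc (Y - X) + (Y - X) * (N * G) * (Y - X)
        = (Y - X) * 1 + (Y - X) * (N * G) * (Y - X) := by rw [mul_one]
      _ = (Y - X) * (N * (1 + G * X)) + (Y - X) * (N * G) * (Y - X) := by rw [hN1]
      _ = (Y - X) * N * (1 + G * Y) := by noncomm_ring
  have h2 : Mᴴ * Y = Y * M := by
    calc Mᴴ * Y = Mᴴ * Y * ((1 + G * Y) * M) := by rw [hM2, mul_one]
      _ = Mᴴ * (1 + Y * G) * (Y * M) := by noncomm_ring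
      _ = Y * M := by rw [hM3, one_mul]
  have h3 : Mᴴ * ((Y - X) + (Y - X) * (N * G) * (Y - X)) * M = Y * M - X * N := by
    calc Mᴴ * ((Y - X) + (Y - X) * (N * G) * (Y - X)) * M
        = Mᴴ * (Y - X) * N * ((1 + G * Y) * M) := by rw [h1]; noncomm_ring
      _ = Mᴴ * Y * ((1 + G * X) * N) - (Mᴴ * (1 + Y * G)) * X * N := by
          rw [hM2]; noncomm_ring
      _ = Y * M - X * N := by rw [hN2, hM3, h2, mul_one, one_mul]
  calc riccati A G H Y - riccati A G H X = Aᴴ * (Y * M - X * N) * A := by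
        simp only [riccati, ← hN, ← hM]; noncomm_ring
    _ = _ := by
        rw [← h3]; simp only [closedLoop, gain, ← hN, ← hM, conjTranspose_mul]
        noncomm_ring

theorem conjTranspose_mul_mul_mono {P Q : Matrix (Fin n) (Fin n) ℂ} (h : P ≤ Q)
    (S : Matrix (Fin n) (Fin n) ℂ) : Sᴴ * P * S ≤ Sᴴ * Q * S :=
  star_left_conjugate_le_conjugate h S

theorem le_add_mul_gain_mul (hG : G.PosSemidef) (hX : X.PosSemidef)
    {E : Matrix (Fin n) (Fin n) ℂ} (hE : 0 ≤ E) : E ≤ E + E * gain G X * E := by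
  refine le_add_of_nonneg_right ?_
  have := ((gain_nonneg hG hX).posSemidef.conjTranspose_mul_mul_same E).nonneg
  rwa [hE.posSemidef.1.eq] at this

/-- The lower bound by the linearization of the Riccati operator at `Y`. -/
theorem closedLoop_conj_le_riccati_sub (A H : Matrix (Fin n) (Fin n) ℂ)
    (hG : G.PosSemidef) (hX : X.PosSemidef) (hY : Y.PosSemidef) (h : X ≤ Y) :
    (closedLoop A G Y)ᴴ * (Y - X) * closedLoop A G Y ≤ riccati A G H Y - riccati A G H X := by
  rw [riccati_sub_riccati A H hG hX hY]
  exact conjTranspose_mul_mul_mono (le_add_mul_gain_mul hG hX (sub_nonneg.2 h)) _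

theorem riccati_mono (A H : Matrix (Fin n) (Fin n) ℂ)
    (hG : G.PosSemidef) (hX : X.PosSemidef) (hY : Y.PosSemidef) (h : X ≤ Y) :
    riccati A G H X ≤ riccati A G H Y := by
  refine sub_nonneg.1 (le_trans ?_ (closedLoop_conj_le_riccati_sub A H hG hX hY h))
  exact ((sub_nonneg.2 h).posSemidef.conjTranspose_mul_mul_same _).nonneg

theorem riccati_zero : riccati A G H 0 = H := by simp [riccati]

theorem le_riccati (A : Matrix (Fin n) (Fin n) ℂ) (H : Matrix (Fin n) (Fin n) ℂ)
    (hG : G.PosSemidef) (hX : X.PosSemidef) : H ≤ riccati A G H X := by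
  simpa [riccati_zero] using riccati_mono A H hG PosSemidef.zero hX hX.nonneg

/-- The difference `G - (I + G X)⁻¹ G` is the congruence by `G` of `X (I + G X)⁻¹`, which is the
Riccati operator for `A = I` and `H = 0`. -/
theorem gain_le (hG : G.PosSemidef) (hX : X.PosSemidef) : gain G X ≤ G := by
  have h1 : G - gain G X = G * (X * (1 + G * X)⁻¹) * G := by
    calc G - gain G X = (1 + G * X) * (1 + G * X)⁻¹ * G - gain G X := by
          rw [mul_inv_self hG hX, one_mul]
      _ = G * (X * (1 + G * X)⁻¹) * G := by rw [gain]; noncomm_ring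
  have h2 : 0 ≤ X * (1 + G * X)⁻¹ := by
    simpa [riccati] using le_riccati 1 0 hG hX
  have h3 := conjTranspose_mul_mul_mono h2 G
  rw [hG.1.eq, mul_zero, zero_mul, ← h1] at h3
  exact sub_nonneg.1 h3

/-- The quadratic term is dominated by a small multiple of `E` once `E` is small. -/
theorem add_mul_gain_mul_le (hG : G.PosSemidef) (hX : X.PosSemidef)
    {E : Matrix (Fin n) (Fin n) ℂ} (hE : 0 ≤ E) :
    E + E * gain G X * E ≤ (1 + ‖G‖ * ‖E‖) • E := by
  obtain ⟨B, rfl⟩ := CStarAlgebra.nonneg_iff_eq_star_mul_self.1 hE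
  have h1 : 0 ≤ B * gain G X * star B :=
    star_right_conjugate_nonneg (gain_nonneg hG hX) B
  have h2 := CStarAlgebra.star_left_conjugate_le_norm_smul (a := B) (IsSelfAdjoint.of_nonneg h1)
  have h3 : ‖B * gain G X * star B‖ ≤ ‖G‖ * ‖star B * B‖ := by
    calc ‖B * gain G X * star B‖ ≤ ‖B‖ * ‖gain G X‖ * ‖star B‖ := by
          refine (norm_mul_le _ _).trans ?_
          gcongr
          exact norm_mul_le _ _
      _ ≤ ‖B‖ * ‖G‖ * ‖star B‖ := by
          gcongr
          exact CStarAlgebra.norm_le_norm_of_nonneg_of_le (gain_nonneg hG hX) (gain_le hG hX)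
      _ = ‖G‖ * ‖star B * B‖ := by rw [norm_star, CStarRing.norm_star_mul_self]; ring
  rw [add_smul, one_smul]
  refine add_le_add_right ?_ _
  calc star B * B * gain G X * (star B * B) = star B * (B * gain G X * star B) * B := by
        noncomm_ring
    _ ≤ ‖B * gain G X * star B‖ • (star B * B) := h2
    _ ≤ _ := smul_le_smul_of_nonneg_right h3 hE

/-! ### Monotone convergence of the fixed-point iteration -/

/-- A monotone sequence of matrices bounded above converges; its limit is an upper bound. -/
theorem exists_tendsto_of_monotone {Z : ℕ → Matrix (Fin n) (Fin n) ℂ}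
    (hZ : Monotone Z) (h0 : 0 ≤ Z 0) (hb : ∀ k, Z k ≤ Y) :
    ∃ L, Tendsto Z atTop (𝓝 L) ∧ ∀ k, Z k ≤ L := by
  have hbd : ∀ k, Z k ∈ Metric.closedBall (0 : Matrix (Fin n) (Fin n) ℂ) ‖Y‖ := fun k => by
    rw [mem_closedBall_zero_iff]
    exact CStarAlgebra.norm_le_norm_of_nonneg_of_le (h0.trans (hZ (Nat.zero_le k))) (hb k)
  have : ProperSpace (Matrix (Fin n) (Fin n) ℂ) := FiniteDimensional.proper ℂ _
  obtain ⟨L, -, φ, hφ, hL⟩ := (isCompact_closedBall _ _).tendsto_subseq hbd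
  have hle : ∀ k, Z k ≤ L := fun k => by
    refine ge_of_tendsto hL ?_
    filter_upwards [eventually_ge_atTop k] with m hm
    exact hZ (hm.trans (hφ.id_le m))
  refine ⟨L, Metric.tendsto_atTop.2 fun ε hε => ?_, hle⟩
  obtain ⟨m, hm⟩ := (Metric.tendsto_atTop.1 hL) ε hε
  refine ⟨φ m, fun k hk => ?_⟩
  -- the distance to the limit is antitone, so it suffices to control it along the subsequence
  refine lt_of_le_of_lt ?_ (hm m le_rfl)
  rw [dist_comm, dist_comm _ L, dist_eq_norm, dist_eq_norm]
  exact CStarAlgebra.norm_le_norm_of_nonneg_of_le (sub_nonneg.2 (hle k))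
    (sub_le_sub_left (hZ hk) L)

theorem riccati_nonneg (A : Matrix (Fin n) (Fin n) ℂ) (hG : G.PosSemidef) (hH : H.PosSemidef)
    (hX : X.PosSemidef) : (riccati A G H X).PosSemidef :=
  (hH.nonneg.trans (le_riccati A H hG hX)).posSemidef

theorem iterate_posSemidef (A : Matrix (Fin n) (Fin n) ℂ) (hG : G.PosSemidef) (hH : H.PosSemidef)
    (k : ℕ) : ((riccati A G H)^[k] 0).PosSemidef := by
  induction k with
  | zero => exact PosSemidef.zero
  | succ k ih => rw [Function.iterate_succ_apply']; exact riccati_nonneg A hG hH ih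

theorem iterate_monotone (A : Matrix (Fin n) (Fin n) ℂ) (hG : G.PosSemidef) (hH : H.PosSemidef) :
    Monotone fun k => (riccati A G H)^[k] 0 := by
  refine monotone_nat_of_le_succ fun k => ?_
  induction k with
  | zero => exact (iterate_posSemidef A hG hH 1).nonneg
  | succ k ih =>
    simp only [Function.iterate_succ_apply'] at ih ⊢
    exact riccati_mono A H hG (iterate_posSemidef A hG hH k)
      (riccati_nonneg A hG hH (iterate_posSemidef A hG hH k)) ih

theorem iterate_le (hG : G.PosSemidef) (hH : H.PosSemidef) (hY : Y.PosSemidef)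
    (hR : riccati A G H Y ≤ Y) (k : ℕ) : (riccati A G H)^[k] 0 ≤ Y := by
  induction k with
  | zero => exact hY.nonneg
  | succ k ih =>
    rw [Function.iterate_succ_apply']
    exact (riccati_mono A H hG (iterate_posSemidef A hG hH k) hY ih).trans hR

/-- The iteration started at `0` increases to the minimal positive semidefinite solution. -/
theorem exists_minimal_tendsto (hG : G.PosSemidef) (hH : H.PosSemidef)
    (hne : (superSolutions A G H).Nonempty) :
    ∃ L, IsMinimalPSDSolution A G H L ∧
      Tendsto (fun k => (riccati A G H)^[k] 0) atTop (𝓝 L) ∧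
      ∀ k, (riccati A G H)^[k] 0 ≤ L := by
  obtain ⟨Y, hY, hYR⟩ := hne
  obtain ⟨L, hL, hle⟩ := exists_tendsto_of_monotone (iterate_monotone A hG hH) le_rfl
    (iterate_le hG hH hY hYR)
  have hLpos : L.PosSemidef := (hle 0).posSemidef
  refine ⟨L, ⟨⟨hLpos, ?_⟩, fun W hW => ?_⟩, hL, hle⟩
  · have hd : Tendsto (fun k => L - (riccati A G H)^[k] 0) atTop (𝓝 0) := by
      simpa using hL.const_sub L
    have h1 : Tendsto (fun k => ‖closedLoop A G L‖ * ((1 + ‖G‖ * ‖L - (riccati A G H)^[k] 0‖) *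
        ‖L - (riccati A G H)^[k] 0‖) * ‖closedLoop A G L‖) atTop (𝓝 0) := by
      have := ((((hd.norm.const_mul ‖G‖).const_add 1).mul hd.norm).const_mul
        ‖closedLoop A G L‖).mul_const ‖closedLoop A G L‖
      simpa using this
    have h2 : Tendsto (fun k => riccati A G H L - (riccati A G H)^[k + 1] 0) atTop (𝓝 0) := by
      refine squeeze_zero_norm (fun k => ?_) h1
      have hp := iterate_posSemidef A hG hH k
      have hE := sub_nonneg.2 (hle k)
      rw [Function.iterate_succ_apply', riccati_sub_riccati A H hG hp hLpos]
      refine (norm_mul_le _ _).trans (mul_le_mul_of_nonneg_right ?_ (norm_nonneg _))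
      refine (norm_mul_le _ _).trans ?_
      rw [← star_eq_conjTranspose, norm_star]
      refine mul_le_mul_of_nonneg_left ?_ (norm_nonneg _)
      refine (CStarAlgebra.norm_le_norm_of_nonneg_of_le
        (hE.trans (le_add_mul_gain_mul hG hp hE)) (add_mul_gain_mul_le hG hp hE)).trans ?_
      rw [norm_smul, Real.norm_of_nonneg (by positivity)]
    have h3 := h2.const_sub (riccati A G H L)
    simp only [sub_sub_cancel, sub_zero] at h3
    exact tendsto_nhds_unique ((tendsto_add_atTop_iff_nat 1).2 hL) h3
  · exact le_of_tendsto' hL (iterate_le hG hH hW.1 hW.2.symm.le)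

/-! ### Spectrum modulo the kernel of a Lyapunov matrix -/

theorem mulVec_mulVec_eq_zero {L T : Matrix (Fin n) (Fin n) ℂ} (hL : L.PosSemidef)
    (hLT : Tᴴ * L * T ≤ L) {v : Fin n → ℂ} (hv : L *ᵥ v = 0) : L *ᵥ (T *ᵥ v) = 0 := by
  have h1 := (Matrix.le_iff.1 hLT).dotProduct_mulVec_nonneg v
  have h2 : star v ⬝ᵥ ((Tᴴ * L * T) *ᵥ v) = star (T *ᵥ v) ⬝ᵥ (L *ᵥ (T *ᵥ v)) := by
    rw [star_mulVec, ← dotProduct_mulVec, mulVec_mulVec, mulVec_mulVec, mul_assoc]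
  rw [sub_mulVec, hv, zero_sub, dotProduct_neg, h2] at h1
  exact (hL.dotProduct_mulVec_zero_iff _).1
    (le_antisymm (neg_nonneg.1 h1) (hL.dotProduct_mulVec_nonneg _))

/-- If `L ≥ 0` and `T^{m*} L T^m → 0`, then `L T^m → 0`. -/
theorem tendsto_mul_pow_zero {L T : Matrix (Fin n) (Fin n) ℂ} (hL : L.PosSemidef)
    (h : Tendsto (fun m : ℕ => (T ^ m)ᴴ * L * T ^ m) atTop (𝓝 0)) :
    Tendsto (fun m : ℕ => L * T ^ m) atTop (𝓝 0) := by
  obtain ⟨B, rfl⟩ := CStarAlgebra.nonneg_iff_eq_star_mul_self.1 hL.nonneg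
  have h1 : Tendsto (fun m : ℕ => ‖B * T ^ m‖ ^ 2) atTop (𝓝 0) := by
    refine (tendsto_zero_iff_norm_tendsto_zero.1 h).congr fun m => ?_
    rw [sq, ← CStarRing.norm_star_mul_self, star_mul, star_eq_conjTranspose (T ^ m)]
    congr 1
    noncomm_ring
  have h2 : Tendsto (fun m : ℕ => ‖B * T ^ m‖) atTop (𝓝 0) := by
    have := h1.sqrt
    simpa [Real.sqrt_sq (norm_nonneg _)] using this
  have h3 := (tendsto_zero_iff_norm_tendsto_zero.2 h2).const_mul (star B)
  simpa [mul_assoc] using h3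

/-- An eigenvalue of the map induced by `T` modulo `ker L` lies in the open unit disk. -/
theorem norm_lt_one_of_mulVec_mulVec_eq {L T : Matrix (Fin n) (Fin n) ℂ} (hL : L.PosSemidef)
    (hLT : Tᴴ * L * T ≤ L) (h : Tendsto (fun m : ℕ => L * T ^ m) atTop (𝓝 0))
    {v : Fin n → ℂ} {z : ℂ} (hv : L *ᵥ v ≠ 0) (hz : L *ᵥ (T *ᵥ v) = z • (L *ᵥ v)) :
    ‖z‖ < 1 := by
  have hpow : ∀ m : ℕ, (L * T ^ m) *ᵥ v = z ^ m • (L *ᵥ v) := by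
    intro m
    induction m with
    | zero => simp
    | succ m ih =>
      have hk : L *ᵥ ((T ^ m) *ᵥ v - z ^ m • v) = 0 := by
        rw [mulVec_sub, mulVec_mulVec, ih, mulVec_smul, sub_self]
      have hk' := mulVec_mulVec_eq_zero hL hLT hk
      rw [mulVec_sub, mulVec_sub, mulVec_smul, mulVec_smul, hz, sub_eq_zero, mulVec_mulVec,
        mulVec_mulVec, mul_assoc, ← pow_succ', smul_smul, ← pow_succ] at hk'
      exact hk'
  by_contra! hz1
  have h1 : Tendsto (fun m : ℕ => ‖(L * T ^ m) *ᵥ v‖) atTop (𝓝 0) := by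
    have hc : Continuous fun M : Matrix (Fin n) (Fin n) ℂ => ‖M *ᵥ v‖ := by fun_prop
    simpa [Function.comp_def] using (hc.tendsto 0).comp h
  have h2 : ‖L *ᵥ v‖ ≤ 0 := by
    refine ge_of_tendsto' h1 fun m => ?_
    rw [hpow, norm_smul, norm_pow]
    exact le_mul_of_one_le_left (norm_nonneg _) (one_le_pow₀ hz1)
  exact hv (norm_le_zero_iff.1 h2)

/-- An eigenvalue of the map induced by `T` modulo `ker L` is an eigenvalue of `T`: otherwise
`z - T` would restrict to a bijection of the invariant subspace `ker L`. -/
theorem mem_spectrum_of_mulVec_mulVec_eq {L T : Matrix (Fin n) (Fin n) ℂ} (hL : L.PosSemidef)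
    (hLT : Tᴴ * L * T ≤ L) {v : Fin n → ℂ} {z : ℂ} (hv : L *ᵥ v ≠ 0)
    (hz : L *ᵥ (T *ᵥ v) = z • (L *ᵥ v)) : z ∈ spectrum ℂ T := by
  by_contra hns
  rw [spectrum.notMem_iff] at hns
  set R : Matrix (Fin n) (Fin n) ℂ := algebraMap ℂ _ z - T with hR
  have hRv : ∀ w, R *ᵥ w = z • w - T *ᵥ w := fun w => by
    rw [hR, sub_mulVec, Algebra.algebraMap_eq_smul_one, smul_mulVec, one_mulVec]
  have hinj : Function.Injective R.mulVecLin := Matrix.mulVec_injective_iff_isUnit.2 hns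
  have hmaps : ∀ w ∈ LinearMap.ker L.mulVecLin, R.mulVecLin w ∈ LinearMap.ker L.mulVecLin := by
    intro w hw
    simp only [LinearMap.mem_ker, mulVecLin_apply] at hw ⊢
    rw [hRv, mulVec_sub, mulVec_smul, hw, mulVec_mulVec_eq_zero hL hLT hw, smul_zero, sub_zero]
  have hinj' : Function.Injective (R.mulVecLin.restrict hmaps) := fun x y hxy =>
    Subtype.ext (hinj (congrArg Subtype.val hxy))
  have hmem : R *ᵥ v ∈ LinearMap.ker L.mulVecLin := by
    rw [LinearMap.mem_ker, mulVecLin_apply, hRv, mulVec_sub, mulVec_smul, hz, sub_self]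
  obtain ⟨w, hw⟩ := LinearMap.injective_iff_surjective.1 hinj' ⟨_, hmem⟩
  have hwv : (w : Fin n → ℂ) = v := hinj (congrArg Subtype.val hw)
  exact hv (hwv ▸ w.2)

theorem exists_mulVec_mulVec_eq {L T : Matrix (Fin n) (Fin n) ℂ} (hL : L.PosSemidef)
    (hLT : Tᴴ * L * T ≤ L) (hL0 : L ≠ 0) :
    ∃ (z : ℂ) (v : Fin n → ℂ), L *ᵥ v ≠ 0 ∧ L *ᵥ (T *ᵥ v) = z • (L *ᵥ v) := by
  set K := LinearMap.ker L.mulVecLin with hK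
  have hKtop : K ≠ ⊤ := fun h => hL0 (by
    rw [hK, LinearMap.ker_eq_top] at h
    exact Matrix.toLin'.injective (h.trans (map_zero _).symm))
  have : Nontrivial ((Fin n → ℂ) ⧸ K) := Submodule.Quotient.nontrivial_iff.2 hKtop
  have hinv : K ≤ K.comap T.mulVecLin := fun w hw => by
    simp only [hK, Submodule.mem_comap, LinearMap.mem_ker, mulVecLin_apply] at hw ⊢
    exact mulVec_mulVec_eq_zero hL hLT hw
  obtain ⟨z, hz⟩ := Module.End.exists_eigenvalue (K.mapQ K T.mulVecLin hinv)
  obtain ⟨x, hx⟩ := hz.exists_hasEigenvector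
  obtain ⟨v, rfl⟩ := K.mkQ_surjective x
  refine ⟨z, v, fun h => hx.2 ((Submodule.Quotient.mk_eq_zero K).2 h), ?_⟩
  have h1 := hx.apply_eq_smul
  rw [Submodule.mkQ_apply, Submodule.mapQ_apply, ← Submodule.Quotient.mk_smul,
    Submodule.Quotient.eq, hK, LinearMap.mem_ker, map_sub, map_smul, sub_eq_zero] at h1
  exact h1

/-- There is a projection along `ker L`. It need not be Hermitian: only its kernel matters. -/
theorem exists_projection (L : Matrix (Fin n) (Fin n) ℂ) :
    ∃ P : Matrix (Fin n) (Fin n) ℂ, P * P = P ∧ L * P = L ∧ ∀ v, P *ᵥ v = 0 ↔ L *ᵥ v = 0 := by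
  obtain ⟨Q, hQ⟩ := (LinearMap.ker L.mulVecLin).exists_isCompl
  set p := Q.projection _ hQ.symm with hp
  have hPv : ∀ v, LinearMap.toMatrix' p *ᵥ v = p v := fun v => by
    rw [← Matrix.toLin'_apply, Matrix.toLin'_toMatrix']
  refine ⟨LinearMap.toMatrix' p, ?_, ?_, fun v => ?_⟩
  · rw [← LinearMap.toMatrix'_mul, (Submodule.isIdempotentElem_projection hQ.symm).eq]
  · refine Matrix.toLin'.injective (LinearMap.ext fun v => ?_)
    rw [toLin'_apply, toLin'_apply, ← mulVec_mulVec, hPv]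
    have h := Submodule.sub_projection_mem hQ.symm v
    rw [LinearMap.mem_ker, mulVecLin_apply, mulVec_sub, sub_eq_zero] at h
    exact h.symm
  · rw [hPv, Submodule.projection_apply_eq_zero_iff, LinearMap.mem_ker, mulVecLin_apply]

theorem mul_projection_eq {L P E : Matrix (Fin n) (Fin n) ℂ} (hE : 0 ≤ E) (hEL : E ≤ L)
    (hP : L * P = L) : E * P = E := by
  refine Matrix.toLin'.injective (LinearMap.ext fun v => ?_)
  rw [toLin'_apply, toLin'_apply, ← mulVec_mulVec, ← sub_eq_zero, ← mulVec_sub]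
  have hk : L *ᵥ (P *ᵥ v - v) = 0 := by rw [mulVec_sub, mulVec_mulVec, hP, sub_self]
  have h1 := (Matrix.le_iff.1 hEL).dotProduct_mulVec_nonneg (P *ᵥ v - v)
  rw [sub_mulVec, hk, zero_sub, dotProduct_neg] at h1
  exact (hE.posSemidef.dotProduct_mulVec_zero_iff _).1
    (le_antisymm (neg_nonneg.1 h1) (hE.posSemidef.dotProduct_mulVec_nonneg _))

/-- Every nonzero eigenvalue of the compression `P T` is an eigenvalue of `T` modulo `ker L`. -/
theorem exists_of_mem_spectrum_projection_mul {L P T : Matrix (Fin n) (Fin n) ℂ}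
    (hPP : P * P = P) (hPL : ∀ v, P *ᵥ v = 0 ↔ L *ᵥ v = 0)
    {z : ℂ} (hz : z ∈ spectrum ℂ (P * T)) (hz0 : z ≠ 0) :
    ∃ v : Fin n → ℂ, L *ᵥ v ≠ 0 ∧ L *ᵥ (T *ᵥ v) = z • (L *ᵥ v) := by
  rw [← Matrix.spectrum_toLin', ← Module.End.hasEigenvalue_iff_mem_spectrum] at hz
  obtain ⟨v, hv⟩ := hz.exists_hasEigenvector
  have h1 : P *ᵥ (T *ᵥ v) = z • v := by
    rw [mulVec_mulVec, ← toLin'_apply]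
    exact hv.apply_eq_smul
  have h2 : P *ᵥ v = v := by
    have := congrArg (P *ᵥ ·) h1
    simp only [mulVec_mulVec, ← mul_assoc, hPP, mulVec_smul] at this
    rw [← mulVec_mulVec, h1] at this
    exact (smul_right_injective _ hz0 this).symm
  refine ⟨v, fun h => hv.2 (h2 ▸ (hPL v).2 h), ?_⟩
  rw [← mulVec_smul, ← sub_eq_zero, ← mulVec_sub, ← hPL, mulVec_sub, h1, mulVec_smul, h2, sub_self]

/-! ### The rate of convergence -/

theorem closedLoop_pow_conj_le (hG : G.PosSemidef) (hH : H.PosSemidef)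
    {L : Matrix (Fin n) (Fin n) ℂ} (hL : IsPSDSolution A G H L)
    (hle : ∀ k, (riccati A G H)^[k] 0 ≤ L) (m : ℕ) :
    (closedLoop A G L ^ m)ᴴ * L * closedLoop A G L ^ m ≤ L - (riccati A G H)^[m] 0 := by
  induction m with
  | zero => simp
  | succ m ih =>
    have h1 := closedLoop_conj_le_riccati_sub A H hG (iterate_posSemidef A hG hH m) hL.1 (hle m)
    rw [← hL.2] at h1
    rw [Function.iterate_succ_apply']
    refine le_trans (le_of_eq ?_) ((conjTranspose_mul_mul_mono ih _).trans h1)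
    rw [pow_succ, conjTranspose_mul]
    noncomm_ring

theorem closedLoop_conj_le (hG : G.PosSemidef) (hH : H.PosSemidef)
    {L : Matrix (Fin n) (Fin n) ℂ} (hL : IsPSDSolution A G H L) :
    (closedLoop A G L)ᴴ * L * closedLoop A G L ≤ L := by
  have h1 := closedLoop_conj_le_riccati_sub A H hG PosSemidef.zero hL.1 hL.1.nonneg
  rw [← hL.2, riccati_zero, sub_zero] at h1
  exact h1.trans (sub_le_self _ hH.nonneg)

theorem tendsto_mul_closedLoop_pow (hG : G.PosSemidef) (hH : H.PosSemidef)
    {L : Matrix (Fin n) (Fin n) ℂ} (hL : IsPSDSolution A G H L)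
    (hle : ∀ k, (riccati A G H)^[k] 0 ≤ L)
    (hlim : Tendsto (fun k => (riccati A G H)^[k] 0) atTop (𝓝 L)) :
    Tendsto (fun m : ℕ => L * closedLoop A G L ^ m) atTop (𝓝 0) := by
  refine tendsto_mul_pow_zero hL.1 ?_
  have h1 : Tendsto (fun k => ‖L - (riccati A G H)^[k] 0‖) atTop (𝓝 0) := by
    simpa using (hlim.const_sub L).norm
  refine squeeze_zero_norm (fun m => ?_) h1
  exact CStarAlgebra.norm_le_norm_of_nonneg_of_le
    (hL.1.conjTranspose_mul_mul_same _).nonneg (closedLoop_pow_conj_le hG hH hL hle m)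

/-- The set of squared moduli of stable closed-loop eigenvalues has a greatest element, which
is less than one. -/
theorem exists_isGreatest_stableSqModuli {L T : Matrix (Fin n) (Fin n) ℂ} (hL : L.PosSemidef)
    (hLT : Tᴴ * L * T ≤ L) (h : Tendsto (fun m : ℕ => L * T ^ m) atTop (𝓝 0)) (hL0 : L ≠ 0) :
    ∃ r, IsGreatest (stableSqModuli T) r ∧ 0 ≤ r ∧ r < 1 := by
  have hfin : (stableSqModuli T).Finite := by
    refine ((Matrix.finite_spectrum T).image fun z => ‖z‖ ^ 2).subset ?_
    rintro s ⟨z, hz, -, rfl⟩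
    exact ⟨z, hz, rfl⟩
  obtain ⟨z, v, hv, hz⟩ := exists_mulVec_mulVec_eq hL hLT hL0
  have hne : (stableSqModuli T).Nonempty :=
    ⟨_, z, mem_spectrum_of_mulVec_mulVec_eq hL hLT hv hz,
      norm_lt_one_of_mulVec_mulVec_eq hL hLT h hv hz, rfl⟩
  obtain ⟨r, hr, hmax⟩ := Set.exists_max_image _ id hfin hne
  refine ⟨r, ⟨hr, hmax⟩, ?_⟩
  obtain ⟨z, -, hz1, rfl⟩ := hr
  exact ⟨by positivity, pow_lt_one₀ (norm_nonneg _) hz1 two_ne_zero⟩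

theorem spectralRadius_projection_mul_le {L P T : Matrix (Fin n) (Fin n) ℂ} (hL : L.PosSemidef)
    (hLT : Tᴴ * L * T ≤ L) (h : Tendsto (fun m : ℕ => L * T ^ m) atTop (𝓝 0))
    (hPP : P * P = P) (hPL : ∀ v, P *ᵥ v = 0 ↔ L *ᵥ v = 0)
    {r : ℝ} (hr : r ∈ upperBounds (stableSqModuli T)) :
    spectralRadius ℂ (P * T) ≤ ENNReal.ofReal √r := by
  refine iSup₂_le fun z hz => ?_
  rcases eq_or_ne z 0 with rfl | hz0
  · simp
  obtain ⟨v, hv, hzv⟩ := exists_of_mem_spectrum_projection_mul hPP hPL hz hz0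
  rw [← enorm_eq_nnnorm, ← ofReal_norm]
  exact ENNReal.ofReal_le_ofReal (Real.le_sqrt_of_sq_le (hr ⟨z,
    mem_spectrum_of_mulVec_mulVec_eq hL hLT hv hzv,
    norm_lt_one_of_mulVec_mulVec_eq hL hLT h hv hzv, rfl⟩))

theorem eventually_norm_pow_le {S : Matrix (Fin n) (Fin n) ℂ} {p : ℝ}
    (h : spectralRadius ℂ S < ENNReal.ofReal p) : ∀ᶠ j : ℕ in atTop, ‖S ^ j‖ ≤ p ^ j := by
  have hp : 0 < p := ENNReal.ofReal_pos.1 (bot_le.trans_lt h)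
  filter_upwards [(spectrum.pow_norm_pow_one_div_tendsto_nhds_spectralRadius S).eventually
    (gt_mem_nhds h), eventually_gt_atTop 0] with j hj hj0
  have h1 := ((ENNReal.ofReal_lt_ofReal_iff hp).1 hj).le
  calc ‖S ^ j‖ = (‖S ^ j‖ ^ (1 / (j : ℝ))) ^ j := by
        rw [one_div, Real.rpow_inv_natCast_pow (norm_nonneg _) hj0.ne']
    _ ≤ p ^ j := pow_le_pow_left₀ (by positivity) h1 j

/-- A sequence with `E_{k+1} ≤ c S* E_k S` is bounded by the powers of `c p²`, for every `p`
above the spectral radius of `S`. -/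
theorem exists_norm_le_pow {E : ℕ → Matrix (Fin n) (Fin n) ℂ} {S : Matrix (Fin n) (Fin n) ℂ}
    {c p : ℝ} (hc : 0 < c) (hE : ∀ k, 0 ≤ E k)
    (hstep : ∀ᶠ k in atTop, E (k + 1) ≤ c • (Sᴴ * E k * S))
    (hp : spectralRadius ℂ S < ENNReal.ofReal p) :
    ∃ C : ℝ, ∀ᶠ k in atTop, ‖E k‖ ≤ C * (c * p ^ 2) ^ k := by
  have hp0 : 0 < p := ENNReal.ofReal_pos.1 (bot_le.trans_lt hp)
  obtain ⟨k₀, hk₀⟩ := eventually_atTop.1 hstep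
  have hiter : ∀ j, E (k₀ + j) ≤ c ^ j • ((S ^ j)ᴴ * E k₀ * S ^ j) := by
    intro j
    induction j with
    | zero => simp
    | succ j ih =>
      refine (hk₀ (k₀ + j) (Nat.le_add_right _ _)).trans ?_
      refine (smul_le_smul_of_nonneg_left (conjTranspose_mul_mul_mono ih S) hc.le).trans
        (le_of_eq ?_)
      rw [pow_succ S, conjTranspose_mul, mul_smul_comm, smul_mul_assoc, smul_smul, ← pow_succ']
      congr 1
      noncomm_ring
  refine ⟨‖E k₀‖ * ((c * p ^ 2) ^ k₀)⁻¹, ?_⟩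
  obtain ⟨j₀, hj₀⟩ := eventually_atTop.1 (eventually_norm_pow_le hp)
  filter_upwards [eventually_ge_atTop (k₀ + j₀)] with k hk
  obtain ⟨j, rfl⟩ := Nat.exists_eq_add_of_le (le_of_add_le_left hk)
  have hj := hj₀ j (by omega)
  calc ‖E (k₀ + j)‖ ≤ ‖c ^ j • ((S ^ j)ᴴ * E k₀ * S ^ j)‖ :=
        CStarAlgebra.norm_le_norm_of_nonneg_of_le (hE _) (hiter j)
    _ ≤ c ^ j * (‖S ^ j‖ * ‖E k₀‖ * ‖S ^ j‖) := by
        rw [norm_smul, Real.norm_of_nonneg (by positivity)]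
        gcongr
        refine (norm_mul_le _ _).trans ?_
        gcongr
        refine (norm_mul_le _ _).trans ?_
        rw [← star_eq_conjTranspose, norm_star]
    _ ≤ c ^ j * (p ^ j * ‖E k₀‖ * p ^ j) := by gcongr
    _ = ‖E k₀‖ * ((c * p ^ 2) ^ k₀)⁻¹ * (c * p ^ 2) ^ (k₀ + j) := by
        rw [pow_add]
        field_simp
        ring

/-- The errors of the iteration are eventually bounded by the powers of any number above the
largest squared modulus of a stable closed-loop eigenvalue. -/
theorem exists_norm_sub_iterate_le (hG : G.PosSemidef) (hH : H.PosSemidef)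
    {L : Matrix (Fin n) (Fin n) ℂ} (hL : IsPSDSolution A G H L)
    (hle : ∀ k, (riccati A G H)^[k] 0 ≤ L)
    (hlim : Tendsto (fun k => (riccati A G H)^[k] 0) atTop (𝓝 L))
    {r q : ℝ} (hr : r ∈ upperBounds (stableSqModuli (closedLoop A G L))) (hr0 : 0 ≤ r)
    (hq : r < q) :
    ∃ C : ℝ, ∀ᶠ k in atTop, ‖L - (riccati A G H)^[k] 0‖ ≤ C * q ^ k := by
  obtain ⟨a, hra, haq⟩ := exists_between hq
  have ha : 0 < a := hr0.trans_lt hra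
  obtain ⟨P, hPP, hLP, hPL⟩ := exists_projection L
  set T := closedLoop A G L with hT
  have hρ : spectralRadius ℂ (P * T) < ENNReal.ofReal √a :=
    (spectralRadius_projection_mul_le hL.1 (closedLoop_conj_le hG hH hL)
      (tendsto_mul_closedLoop_pow hG hH hL hle hlim) hPP hPL hr).trans_lt
      ((ENNReal.ofReal_lt_ofReal_iff (Real.sqrt_pos.2 ha)).2 (Real.sqrt_lt_sqrt hr0 hra))
  have hc : q / a * √a ^ 2 = q := by rw [Real.sq_sqrt ha.le]; field_simp
  rw [← hc]
  refine exists_norm_le_pow (div_pos (ha.trans haq) ha) (fun k => sub_nonneg.2 (hle k)) ?_ hρ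
  have hsmall : Tendsto (fun k => 1 + ‖G‖ * ‖L - (riccati A G H)^[k] 0‖) atTop (𝓝 1) := by
    simpa using (((hlim.const_sub L).norm.const_mul ‖G‖).const_add 1)
  filter_upwards [hsmall.eventually (ge_mem_nhds ((one_lt_div ha).2 haq))] with k hk
  have hZ := iterate_posSemidef A hG hH k
  have hE := sub_nonneg.2 (hle k)
  have hEP : (L - (riccati A G H)^[k] 0) * P = L - (riccati A G H)^[k] 0 :=
    mul_projection_eq hE (sub_le_self _ hZ.nonneg) hLP
  have hdiff := riccati_sub_riccati A H hG hZ hL.1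
  rw [← hL.2, ← hT] at hdiff
  rw [Function.iterate_succ_apply', hdiff]
  generalize L - (riccati A G H)^[k] 0 = E at *
  have hPE : Pᴴ * E = E := by
    simpa [hE.posSemidef.1.eq] using congrArg conjTranspose hEP
  calc _ ≤ Tᴴ * ((q / a) • E) * T := by
        refine conjTranspose_mul_mul_mono ((add_mul_gain_mul_le hG hZ hE).trans ?_) T
        exact smul_le_smul_of_nonneg_right hk hE
    _ = (q / a) • ((P * T)ᴴ * E * (P * T)) := by
        rw [mul_smul_comm, smul_mul_assoc]
        congr 1
        calc Tᴴ * E * T = Tᴴ * (Pᴴ * (E * P)) * T := by rw [hEP, hPE]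
          _ = (P * T)ᴴ * E * (P * T) := by rw [conjTranspose_mul]; noncomm_ring

theorem exists_seminorm_le (ν : Seminorm ℂ (Matrix (Fin n) (Fin n) ℂ)) :
    ∃ C : ℝ, 0 < C ∧ ∀ M, ν M ≤ C * ‖M‖ := by
  have hν : Continuous ν := by
    have h := (ν.restrictScalars ℝ).convexOn
    have : FiniteDimensional ℝ (Matrix (Fin n) (Fin n) ℂ) := FiniteDimensional.trans ℝ ℂ _
    exact continuousOn_univ.1 (h.continuousOn isOpen_univ)
  exact Seminorm.bound_of_continuous_normedSpace ν hν

/-- Geometric bounds in the operator norm for all ratios above `r` bound the root rate by `r` for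
every seminorm, since seminorms are bounded in finite dimension. -/
theorem rootRate_le {X : ℕ → Matrix (Fin n) (Fin n) ℂ} {L : Matrix (Fin n) (Fin n) ℂ} {r : ℝ}
    (hr0 : 0 ≤ r)
    (h : ∀ q, r < q → ∃ C : ℝ, ∀ᶠ k in atTop, ‖X k - L‖ ≤ C * q ^ k)
    (ν : Seminorm ℂ (Matrix (Fin n) (Fin n) ℂ)) : rootRate ν X L ≤ (r : EReal) := by
  obtain ⟨D, hD, hν⟩ := exists_seminorm_le ν
  refine EReal.le_of_forall_lt_iff_le.1 fun q hq => ?_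
  rw [EReal.coe_lt_coe_iff] at hq
  obtain ⟨p, hrp, hpq⟩ := exists_between hq
  have hp : 0 < p := hr0.trans_lt hrp
  have hq0 : 0 < q := hp.trans hpq
  obtain ⟨C, hC⟩ := h p hrp
  -- the constant is absorbed by the gap between `p` and `q`
  have hgap : Tendsto (fun k : ℕ => D * C * (p / q) ^ k) atTop (𝓝 0) := by
    simpa using (tendsto_pow_atTop_nhds_zero_of_lt_one (by positivity)
      ((div_lt_one hq0).2 hpq)).const_mul (D * C)
  refine limsup_le_of_le (by isBoundedDefault) ?_
  filter_upwards [hC, hgap.eventually (ge_mem_nhds one_pos), eventually_gt_atTop 0]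
    with k hk hk1 hk0
  rw [EReal.coe_le_coe_iff]
  have h1 : ν (X k - L) ≤ q ^ k := by
    calc ν (X k - L) ≤ D * (C * p ^ k) := (hν _).trans (by gcongr)
      _ = D * C * (p / q) ^ k * q ^ k := by rw [div_pow]; field_simp
      _ ≤ 1 * q ^ k := by gcongr
      _ = q ^ k := one_mul _
  calc ν (X k - L) ^ (1 / (k : ℝ)) ≤ (q ^ k) ^ (1 / (k : ℝ)) :=
        Real.rpow_le_rpow (apply_nonneg ν _) h1 (by positivity)
    _ = q := by rw [one_div, Real.pow_rpow_inv_natCast hq0.le hk0.ne']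

theorem eq_iterate {X : ℕ → Matrix (Fin n) (Fin n) ℂ} (hX1 : X 1 = H)
    (hX : ∀ k : ℕ, 1 ≤ k → X (k + 1) = riccati A G H (X k)) {k : ℕ} (hk : 1 ≤ k) :
    X k = (riccati A G H)^[k] 0 := by
  induction k, hk using Nat.le_induction with
  | base => simp [hX1, riccati_zero]
  | succ k hk ih => rw [hX k hk, ih, Function.iterate_succ_apply']

/-- A nonzero constant term forces the solution to have stable closed-loop eigenvalues, and the
largest of their squared moduli bounds the rate of convergence. -/
theorem exists_rate (hG : G.PosSemidef) (hH : H.PosSemidef) (hH0 : H ≠ 0)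
    {L : Matrix (Fin n) (Fin n) ℂ} (hL : IsPSDSolution A G H L)
    (hle : ∀ k, (riccati A G H)^[k] 0 ≤ L)
    (hlim : Tendsto (fun k => (riccati A G H)^[k] 0) atTop (𝓝 L))
    {X : ℕ → Matrix (Fin n) (Fin n) ℂ} (hXZ : ∀ᶠ k in atTop, X k = (riccati A G H)^[k] 0) :
    ∃ r, IsGreatest (stableSqModuli (closedLoop A G L)) r ∧ r < 1 ∧
      ∀ ν : Seminorm ℂ (Matrix (Fin n) (Fin n) ℂ),
        RLinearlyConverges ν X L ∧ rootRate ν X L ≤ (r : EReal) := by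
  have hL0 : L ≠ 0 := by
    rintro rfl
    have h1 := hle 1
    rw [Function.iterate_one, riccati_zero] at h1
    exact hH0 (le_antisymm h1 hH.nonneg)
  obtain ⟨r, hr, hr0, hr1⟩ := exists_isGreatest_stableSqModuli hL.1 (closedLoop_conj_le hG hH hL)
    (tendsto_mul_closedLoop_pow hG hH hL hle hlim) hL0
  have hrate : ∀ ν : Seminorm ℂ (Matrix (Fin n) (Fin n) ℂ), rootRate ν X L ≤ (r : EReal) := by
    refine rootRate_le hr0 fun q hq => ?_
    obtain ⟨C, hC⟩ := exists_norm_sub_iterate_le hG hH hL hle hlim hr.2 hr0 hq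
    refine ⟨C, ?_⟩
    filter_upwards [hC, hXZ] with k hk hXk
    rwa [hXk, norm_sub_rev]
  refine ⟨r, hr, hr1, fun ν => ⟨⟨(1 + r) / 2, by linarith, by linarith, (hrate ν).trans ?_⟩,
    hrate ν⟩⟩
  rw [EReal.coe_le_coe_iff]
  linarith

theorem eq_zero_of_constant_term_eq_zero {L : Matrix (Fin n) (Fin n) ℂ}
    (hL : IsMinimalPSDSolution A G 0 L) : L = 0 :=
  le_antisymm (hL.2 0 ⟨PosSemidef.zero, riccati_zero.symm⟩) hL.1.1.nonneg

end

end DARE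

theorem theorem3p3 (n : ℕ) (A G H : Matrix (Fin n) (Fin n) ℂ)
    (hG : G.PosSemidef) (hH : H.PosSemidef)
    (hne : (DARE.superSolutions A G H).Nonempty)
    (X : ℕ → Matrix (Fin n) (Fin n) ℂ) (hX1 : X 1 = H)
    (hX : ∀ k : ℕ, 1 ≤ k → X (k + 1) = DARE.riccati A G H (X k)) :
    ∃ Xs : Matrix (Fin n) (Fin n) ℂ,
      DARE.IsMinimalPSDSolution A G H Xs ∧
      (H ≠ 0 →
        Filter.Tendsto X Filter.atTop (nhds Xs) ∧
        ∃ r : ℝ, IsGreatest (DARE.stableSqModuli (DARE.closedLoop A G Xs)) r ∧ r < 1 ∧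
          ∀ ν : Seminorm ℂ (Matrix (Fin n) (Fin n) ℂ), (∀ M, ν M = 0 → M = 0) →
            DARE.RLinearlyConverges ν X Xs ∧ DARE.rootRate ν X Xs ≤ (r : EReal)) ∧
      (H = 0 →
        Xs = 0 ∧ (∀ k : ℕ, 1 ≤ k → X k = 0) ∧
        spectralRadius ℂ (DARE.closedLoop A G Xs) = spectralRadius ℂ A) := by
  obtain ⟨L, hL, hlim, hle⟩ := DARE.exists_minimal_tendsto hG hH hne
  have hXZ : ∀ᶠ k in Filter.atTop, X k = (DARE.riccati A G H)^[k] 0 := by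
    filter_upwards [Filter.eventually_ge_atTop 1] with k hk using DARE.eq_iterate hX1 hX hk
  refine ⟨L, hL, fun hH0 => ⟨hlim.congr' (hXZ.mono fun k hk => hk.symm), ?_⟩, fun hH0 => ?_⟩
  · obtain ⟨r, hr, hr1, hrate⟩ := DARE.exists_rate hG hH hH0 hL.1 hle hlim hXZ
    exact ⟨r, hr, hr1, fun ν _ => hrate ν⟩
  · subst hH0
    obtain rfl : L = 0 := DARE.eq_zero_of_constant_term_eq_zero hL
    refine ⟨rfl, fun k hk => ?_, by simp [DARE.closedLoop]⟩
    rw [DARE.eq_iterate hX1 hX hk]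
    exact Function.iterate_fixed DARE.riccati_zero k
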